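/- Let $\mu(v)=(2\pi)^{-3/2}e^{-|v|^2/2}$ on $\mathbb{R}^3$, let $0\le\theta\le1$, and let $B(\omega,V)\ge 0$ be a measurable collision kernel on $\mathbb{S}^2\times\mathbb{R}^3$ with angular cutoff: for some constant $K$, $\int_{\mathbb{S}^2}B(\omega,V)\,d\omega\le K|V|^{\theta}$ for all $V\in\mathbb{R}^3$. Put $$Q(F,G)(v)=\iint_{\mathbb{R}^3\times\mathbb{S}^2}B(\omega,v-u)F(v')G(u')\,d\omega\,du-F(v)\iint_{\mathbb{R}^3\times\mathbb{S}^2}B(\omega,v-u)G(u)\,d\omega\,du,$$ with $v'=v-((v-u)\cdot\omega)\omega$ and $u'=u+((v-u)\cdot\omega)\omega$, and $\Gamma(f,g)=\mu^{-1/2}Q(\sqrt\mu f,\sqrt\mu g)$. Let $\Omega\subset\mathbb{R}^3$ be a set (for instance a bounded open set with $C^2$ boundary, or the empty set), $\Omega^c=\mathbb{R}^3\setminus\overline{\Omega}$, and let $\|\cdot\|_p$ be the norm of $L^p(\Omega^c\times\mathbb{R}^3)$, with values in $[0,\infty]$ (where $0\cdot\infty=0$). For a measurable $f$ on $\Omega^c\times\mathbb{R}^3$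 with $f(x,\cdot)\in L^2(\mathbb{R}^3)$ for almost every $x$, let $$\mathbf{P}f=\sqrt\mu\Big[a_f+b_f\cdot v+c_f\,\tfrac{|v|^2-3}{2}\Big]$$ be the $L^2(dv)$-orthogonal projection of $f(x,\cdot)$ onto $\mathrm{span}\{1,v_1,v_2,v_3,|v|^2\}\sqrt\mu$, that is, $a_f=\int f\sqrt\mu\,dv$, $b_f=\int f\,v\sqrt\mu\,dv$, $c_f=\int f\,\tfrac{|v|^2-3}{3}\sqrt\mu\,dv$. There is a constant $C$, depending only on $B$ (and $\theta$), such that for all such $\Omega$, $f$, $g$ the integrals defining $\Gamma(\mathbf{P}f,\mathbf{P}g)$ and $\Gamma(\mathbf{P}g,\mathbf{P}f)$ converge absolutely, and, for every splitting $a_f=\tilde a+\bar a$, $b_f=\tilde b+\bar b$, $c_f=\tilde c+\bar c$ (almost everywhere in $\Omega^c$) into measurable functions, with $$S_1f=\sqrt\mu\Big[\tilde a+\tilde b\cdot v+\tilde c\,\tfrac{|v|^2-3}{2}\Big],\qquad S_2f=\sqrt\mu\Big[\bar a+\bar b\cdot v+\bar c\,\tfrac{|v|^2-3}{2}\Big],$$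 one has $$\|\Gamma(\mathbf{P}f,\mathbf{P}g)\|_2+\|\Gamma(\mathbf{P}g,\mathbf{P}f)\|_2\le C\Big(\|S_1f\|_6\,\|\mathbf{P}g\|_2^{2/3}\,\|g\|_\infty^{1/3}+\|S_2f\|_2\,\|g\|_\infty\Big).$$ Moreover, the density component of $f$ does not contribute to $\Gamma(\mathbf{P}f,\mathbf{P}g)+\Gamma(\mathbf{P}g,\mathbf{P}f)$: $\Gamma(\sqrt\mu\,a_f,\mathbf{P}g)+\Gamma(\mathbf{P}g,\sqrt\mu\,a_f)=0$. -/

import Mathlib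

open MeasureTheory
open scoped ENNReal NNReal RealInnerProductSpace

noncomputable section

namespace Boltzmann

/-- Physical space and velocity space `ℝ³`, with the Euclidean norm. -/
abbrev R3 : Type := EuclideanSpace ℝ (Fin 3)

/-- The unit sphere of `ℝ³`. -/
abbrev S2 : Type := Metric.sphere (0 : R3) 1

/-- The surface measure on the unit sphere (of total mass `4 π`). -/
def surface : Measure S2 := (volume : Measure R3).toSphere

/-- The global Maxwellian `μ(v) = (2π)^(-3/2) exp(-|v|²/2)`. -/
def maxwellian (v : R3) : ℝ :=
  ((2 * Real.pi) ^ (3 / 2 : ℝ))⁻¹ * Real.exp (-‖v‖ ^ 2 / 2)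

/-- The square root of the global Maxwellian. -/
def sqrtMax (v : R3) : ℝ := Real.sqrt (maxwellian v)

/-! ### The collision operator -/

/-- A collision kernel `B(ω, V)` with angular cutoff and growth exponent `θ`: it is non-negative
and measurable, and `∫_{S²} B(ω, V) dω ≤ K |V|^θ` for a constant `K`. The integral is taken in
`[0, ∞]`, so its finiteness is part of the condition. -/
structure IsCutoffKernel (θ : ℝ) (B : S2 → R3 → ℝ) : Prop where
  measurable : Measurable (Function.uncurry B)
  nonneg : ∀ ω V, 0 ≤ B ω V
  angular_bound : ∃ K : ℝ, ∀ V : R3,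
    ∫⁻ ω, ENNReal.ofReal (B ω V) ∂surface ≤ ENNReal.ofReal (K * ‖V‖ ^ θ)

/-- Post-collisional velocity `v' = v - ((v - u) · ω) ω`. -/
def vPost (v u : R3) (ω : S2) : R3 := v - ⟪v - u, (ω : R3)⟫ • (ω : R3)

/-- Post-collisional velocity `u' = u + ((v - u) · ω) ω`. -/
def uPost (v u : R3) (ω : S2) : R3 := u + ⟪v - u, (ω : R3)⟫ • (ω : R3)

/-- The integrand, in `(u, ω)`, of the gain term. -/
def gainIntegrand (B : S2 → R3 → ℝ) (F G : R3 → ℝ) (v : R3) (p : R3 × S2) : ℝ :=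
  B p.2 (v - p.1) * F (vPost v p.1 p.2) * G (uPost v p.1 p.2)

/-- The integrand, in `(u, ω)`, of the loss term. -/
def lossIntegrand (B : S2 → R3 → ℝ) (G : R3 → ℝ) (v : R3) (p : R3 × S2) : ℝ :=
  B p.2 (v - p.1) * G p.1

/-- `Q⁺(F, G)(v) = ∬ B(ω, v - u) F(v') G(u') dω du`. -/
def gain (B : S2 → R3 → ℝ) (F G : R3 → ℝ) (v : R3) : ℝ :=
  ∫ p, gainIntegrand B F G v p ∂((volume : Measure R3).prod surface)

/-- `Q⁻(F, G)(v) = F(v) ∬ B(ω, v - u) G(u) dω du`. -/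
def loss (B : S2 → R3 → ℝ) (F G : R3 → ℝ) (v : R3) : ℝ :=
  F v * ∫ p, lossIntegrand B G v p ∂((volume : Measure R3).prod surface)

/-- The Boltzmann collision operator `Q = Q⁺ - Q⁻`. -/
def collision (B : S2 → R3 → ℝ) (F G : R3 → ℝ) (v : R3) : ℝ :=
  gain B F G v - loss B F G v

/-- The nonlinear collision operator `Γ(φ, ψ) = μ^(-1/2) Q(√μ φ, √μ ψ)` on functions of `v`. -/
def nlCollision (B : S2 → R3 → ℝ) (φ ψ : R3 → ℝ) (v : R3) : ℝ :=
  (sqrtMax v)⁻¹ *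
    collision B (fun w => sqrtMax w * φ w) (fun w => sqrtMax w * ψ w) v

/-- Both integrals that define `Γ(φ, ψ)(v)` converge absolutely. -/
def NlCollisionConverges (B : S2 → R3 → ℝ) (φ ψ : R3 → ℝ) (v : R3) : Prop :=
  Integrable (gainIntegrand B (fun w => sqrtMax w * φ w) (fun w => sqrtMax w * ψ w) v)
      ((volume : Measure R3).prod surface) ∧
    Integrable (lossIntegrand B (fun w => sqrtMax w * ψ w) v)
      ((volume : Measure R3).prod surface)

/-! ### The fluid part -/

/-- `√μ(v) [a(x) + b(x) · v + c(x) (|v|² - 3)/2]`. -/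
def fluid (a : R3 → ℝ) (b : R3 → R3) (c : R3 → ℝ) (x v : R3) : ℝ :=
  sqrtMax v * (a x + ⟪b x, v⟫ + c x * ((‖v‖ ^ 2 - 3) / 2))

/-- The density `a_f(x) = ⟨f(x, ·), √μ⟩`. -/
def densityOf (f : R3 → R3 → ℝ) (x : R3) : ℝ := ∫ v, f x v * sqrtMax v

/-- The velocity `b_f(x) = ⟨f(x, ·), v √μ⟩`. -/
def velocityOf (f : R3 → R3 → ℝ) (x : R3) : R3 := ∫ v, (f x v * sqrtMax v) • v

/-- The temperature `c_f(x) = ⟨f(x, ·), (|v|² - 3)/3 √μ⟩`. -/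
def temperatureOf (f : R3 → R3 → ℝ) (x : R3) : ℝ :=
  ∫ v, f x v * ((‖v‖ ^ 2 - 3) / 3) * sqrtMax v

/-- `P f`: for each `x`, the `L²(dv)`-orthogonal projection of `f(x, ·)` onto
`span {√μ, v₁√μ, v₂√μ, v₃√μ, |v|²√μ}`, written in the orthonormal basis
`√μ, v_i √μ, (|v|² - 3)/√6 √μ`. -/
def fluidProj (f : R3 → R3 → ℝ) : R3 → R3 → ℝ :=
  fluid (densityOf f) (velocityOf f) (temperatureOf f)

/-! ### Norms and splittings on the exterior domain -/

/-- The exterior domain `Ω^c = ℝ³ \ closure Ω`. -/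
def exterior (Ω : Set R3) : Set R3 := (closure Ω)ᶜ

/-- Lebesgue measure `dx dv` on `Ω^c × ℝ³`. -/
def phaseMeasure (Ω : Set R3) : Measure (R3 × R3) :=
  ((volume : Measure R3).restrict (exterior Ω)).prod volume

/-- The norm of `L^p(Ω^c × ℝ³)`, with values in `[0, ∞]`. -/
def phaseNorm (Ω : Set R3) (p : ℝ≥0∞) (h : R3 → R3 → ℝ) : ℝ≥0∞ :=
  eLpNorm (Function.uncurry h) p (phaseMeasure Ω)

/-- `f` is measurable on `Ω^c × ℝ³` and `f(x, ·) ∈ L²(ℝ³)` for almost every `x ∈ Ω^c`, so that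
`P f` makes sense. -/
structure IsPhaseFunction (Ω : Set R3) (f : R3 → R3 → ℝ) : Prop where
  measurable : AEStronglyMeasurable (Function.uncurry f) (phaseMeasure Ω)
  slice : ∀ᵐ x ∂(volume : Measure R3).restrict (exterior Ω), MemLp (f x) 2 volume

/-- `a_f = a₁ + a₂`, `b_f = b₁ + b₂`, `c_f = c₁ + c₂` almost everywhere in `Ω^c`, with measurable
summands. With `S₁ f = fluid a₁ b₁ c₁` and `S₂ f = fluid a₂ b₂ c₂` this is a splitting
`P f = S₁ f + S₂ f`. -/
structure IsFluidSplitting (Ω : Set R3) (f : R3 → R3 → ℝ)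
    (a₁ : R3 → ℝ) (b₁ : R3 → R3) (c₁ : R3 → ℝ)
    (a₂ : R3 → ℝ) (b₂ : R3 → R3) (c₂ : R3 → ℝ) : Prop where
  measurable_a₁ : AEStronglyMeasurable a₁ (volume.restrict (exterior Ω))
  measurable_b₁ : AEStronglyMeasurable b₁ (volume.restrict (exterior Ω))
  measurable_c₁ : AEStronglyMeasurable c₁ (volume.restrict (exterior Ω))
  measurable_a₂ : AEStronglyMeasurable a₂ (volume.restrict (exterior Ω))
  measurable_b₂ : AEStronglyMeasurable b₂ (volume.restrict (exterior Ω))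
  measurable_c₂ : AEStronglyMeasurable c₂ (volume.restrict (exterior Ω))
  density : ∀ᵐ x ∂(volume : Measure R3).restrict (exterior Ω), densityOf f x = a₁ x + a₂ x
  velocity : ∀ᵐ x ∂(volume : Measure R3).restrict (exterior Ω), velocityOf f x = b₁ x + b₂ x
  temperature :
    ∀ᵐ x ∂(volume : Measure R3).restrict (exterior Ω), temperatureOf f x = c₁ x + c₂ x

end Boltzmann

end

open Boltzmann

/-!
Everything reduces to the five coefficients `(a, b, c)` of a fluid state, because a collision of two
fluid states is bilinear in their coefficients and Gaussian in the velocity.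

Conservation of energy gives `μ(v') μ(u') = μ(v) μ(u)` and bounds the polynomial factors at the
post-collisional velocities by those at `v` and `u`. Hence the gain and loss integrands of fluid
states are dominated by multiples of `B(ω, v - u) μ(u) (1 + |u|²)²`, whose integral the cutoff
condition bounds by `M (1 + |v|²)` (`exists_integral_kernelMoment_le`). This yields absolute
convergence and the pointwise bound `|Γ(φ, ψ)(v)| ≤ M |A| |G| (1 + |v|²)³ √μ(v)` for fluid states
`φ`, `ψ` with coefficients `A`, `G` (`exists_abs_nlCollision_fluidState_le`), so the `L²` norm of
`Γ(Pf, Pg)` is at most a constant times the `L²(dx)` norm of `|A_f| |A_g|`.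

With `A_f = A₁ + A₂`, Hölder's inequality gives `‖|A₁| |A_g|‖₂ ≤ ‖A₁‖₆ ‖A_g‖₃`,
interpolation gives `‖A_g‖₃ ≤ ‖A_g‖_∞^{1/3} ‖A_g‖₂^{2/3}`, and `‖|A₂| |A_g|‖₂ ≤ ‖A₂‖₂ ‖A_g‖_∞`.
Two comparisons return to phase space: `|A_g| ≤ K ‖g‖_∞` almost everywhere
(`exists_enorm_coeffOf_le`), and `‖A‖_p ≤ K ‖S‖_p` for the fluid state `S` with coefficients `A`
(`exists_eLpNorm_coeff_le`). The latter holds since `A ↦ S` is an injective linear map from a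
finite-dimensional space into `L^p(dv)`, so no Gaussian moment has to be evaluated.

The density component drops out since `1`, `v` and `|v|²` are collisional invariants: in the
symmetrized operator the gain and loss integrands coincide
(`nlCollision_sqrtMax_add_nlCollision_sqrtMax`).
-/

namespace Boltzmann

/-! ### Gaussian weights -/

lemma maxwellian_nonneg (v : R3) : 0 ≤ maxwellian v := by
  unfold maxwellian; positivity

lemma maxwellian_pos (v : R3) : 0 < maxwellian v := by
  unfold maxwellian; positivity

lemma sqrtMax_pos (v : R3) : 0 < sqrtMax v := Real.sqrt_pos.2 (maxwellian_pos v)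

lemma sqrtMax_mul_self (v : R3) : sqrtMax v * sqrtMax v = maxwellian v :=
  Real.mul_self_sqrt (maxwellian_nonneg v)

@[fun_prop]
lemma continuous_maxwellian : Continuous maxwellian := by
  unfold maxwellian; fun_prop

@[fun_prop]
lemma continuous_sqrtMax : Continuous sqrtMax := by
  unfold sqrtMax; fun_prop

lemma sqrtMax_eq (v : R3) :
    sqrtMax v = Real.sqrt (((2 * Real.pi) ^ (3 / 2 : ℝ))⁻¹) * Real.exp (-(1 / 4) * ‖v‖ ^ 2) := by
  rw [sqrtMax, maxwellian, Real.sqrt_mul (by positivity)]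
  congr 1
  rw [Real.sqrt_eq_iff_mul_self_eq (by positivity) (by positivity), ← Real.exp_add]
  congr 1
  ring

/-- A Gaussian absorbs any power of `1 + |v|²` at the price of half its rate of decay. -/
lemma exists_one_add_sq_pow_mul_exp_le (k : ℕ) {b : ℝ} (hb : 0 < b) :
    ∃ C : ℝ, 0 ≤ C ∧ ∀ v : R3, (1 + ‖v‖ ^ 2) ^ k * Real.exp (-b * ‖v‖ ^ 2) ≤
      C * Real.exp (-(b / 2) * ‖v‖ ^ 2) := by
  refine ⟨(k.factorial : ℝ) * (2 / b) ^ k * Real.exp (b / 2), by positivity, fun v => ?_⟩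
  have h := Real.pow_div_factorial_le_exp (b / 2 * (1 + ‖v‖ ^ 2)) (by positivity) k
  rw [div_le_iff₀ (by positivity)] at h
  have hpow : (1 + ‖v‖ ^ 2) ^ k = (2 / b) ^ k * (b / 2 * (1 + ‖v‖ ^ 2)) ^ k := by
    rw [← mul_pow]; congr 1; field_simp
  have hexp : Real.exp (b / 2 * (1 + ‖v‖ ^ 2)) * Real.exp (-b * ‖v‖ ^ 2) =
      Real.exp (b / 2) * Real.exp (-(b / 2) * ‖v‖ ^ 2) := by
    rw [← Real.exp_add, ← Real.exp_add]; congr 1; ring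
  calc (1 + ‖v‖ ^ 2) ^ k * Real.exp (-b * ‖v‖ ^ 2)
      ≤ (2 / b) ^ k * (Real.exp (b / 2 * (1 + ‖v‖ ^ 2)) * k.factorial) *
          Real.exp (-b * ‖v‖ ^ 2) := by rw [hpow]; gcongr
    _ = (2 / b) ^ k * k.factorial *
          (Real.exp (b / 2 * (1 + ‖v‖ ^ 2)) * Real.exp (-b * ‖v‖ ^ 2)) := by ring
    _ = _ := by rw [hexp]; ring

lemma integrable_exp_neg_mul_sq_norm {b : ℝ} (hb : 0 < b) :
    Integrable (fun v : R3 => Real.exp (-b * ‖v‖ ^ 2)) := by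
  have h := (GaussianFourier.integrable_cexp_neg_mul_sq_norm_add (V := R3) (b := (b : ℂ))
    (by simpa using hb) 0 0).re
  refine h.congr (Filter.Eventually.of_forall fun v => ?_)
  have : (-(b : ℂ) * (‖v‖ : ℂ) ^ 2 + 0 * ((⟪(0 : R3), v⟫ : ℝ) : ℂ)) =
      ((-b * ‖v‖ ^ 2 : ℝ) : ℂ) := by push_cast; ring
  simp only [this, ← Complex.ofReal_exp]
  exact Complex.ofReal_re _

lemma memLp_exp_neg_mul_sq_norm {b : ℝ} (hb : 0 < b) {p : ℝ≥0∞} (hp0 : p ≠ 0) (hp : p ≠ ∞) :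
    MemLp (fun v : R3 => Real.exp (-b * ‖v‖ ^ 2)) p := by
  refine (integrable_norm_rpow_iff (by fun_prop) hp0 hp).1 ?_
  have h0 := ENNReal.toReal_pos hp0 hp
  refine (integrable_exp_neg_mul_sq_norm (mul_pos hb h0)).congr
    (Filter.Eventually.of_forall fun v => ?_)
  simp only [Real.norm_eq_abs, Real.abs_exp]
  rw [← Real.exp_mul]
  congr 1
  ring

lemma memLp_one_add_sq_pow_mul_exp (k : ℕ) {b : ℝ} (hb : 0 < b) {p : ℝ≥0∞} (hp0 : p ≠ 0)
    (hp : p ≠ ∞) : MemLp (fun v : R3 => (1 + ‖v‖ ^ 2) ^ k * Real.exp (-b * ‖v‖ ^ 2)) p := by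
  obtain ⟨C, -, hC⟩ := exists_one_add_sq_pow_mul_exp_le k hb
  refine ((memLp_exp_neg_mul_sq_norm (half_pos hb) hp0 hp).const_mul C).mono'
    (by fun_prop) (Filter.Eventually.of_forall fun v => ?_)
  rw [Real.norm_of_nonneg (by positivity)]
  exact hC v

lemma memLp_one_add_sq_pow_mul_sqrtMax (k : ℕ) {p : ℝ≥0∞} (hp0 : p ≠ 0) (hp : p ≠ ∞) :
    MemLp (fun v : R3 => (1 + ‖v‖ ^ 2) ^ k * sqrtMax v) p := by
  refine ((memLp_one_add_sq_pow_mul_exp k (b := 1 / 4) (by norm_num) hp0 hp).const_mul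
    (Real.sqrt (((2 * Real.pi) ^ (3 / 2 : ℝ))⁻¹))).ae_eq
    (Filter.Eventually.of_forall fun v => ?_)
  simp only [sqrtMax_eq]
  ring

lemma integrable_one_add_sq_pow_mul_maxwellian (k : ℕ) :
    Integrable (fun v : R3 => (1 + ‖v‖ ^ 2) ^ k * maxwellian v) := by
  refine ((memLp_one_iff_integrable.1 (memLp_one_add_sq_pow_mul_exp k (b := 1 / 2)
    (by norm_num) one_ne_zero ENNReal.one_ne_top)).const_mul
    (((2 * Real.pi) ^ (3 / 2 : ℝ))⁻¹)).congr (Filter.Eventually.of_forall fun v => ?_)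
  simp only [maxwellian]
  rw [show -‖v‖ ^ 2 / 2 = -(1 / 2) * ‖v‖ ^ 2 by ring]
  ring

/-! ### Collisional invariants -/

lemma norm_coe_sphere (ω : S2) : ‖(ω : R3)‖ = 1 := by simp

lemma vPost_add_uPost (v u : R3) (ω : S2) : vPost v u ω + uPost v u ω = v + u := by
  simp only [vPost, uPost]; abel

/-- Conservation of kinetic energy in a collision. -/
lemma norm_sq_vPost_add_norm_sq_uPost (v u : R3) (ω : S2) :
    ‖vPost v u ω‖ ^ 2 + ‖uPost v u ω‖ ^ 2 = ‖v‖ ^ 2 + ‖u‖ ^ 2 := by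
  simp only [vPost, uPost, norm_sub_sq_real, norm_add_sq_real, norm_smul, inner_smul_right,
    inner_sub_left, norm_coe_sphere, mul_one, Real.norm_eq_abs, sq_abs]
  ring

lemma maxwellian_vPost_mul_uPost (v u : R3) (ω : S2) :
    maxwellian (vPost v u ω) * maxwellian (uPost v u ω) = maxwellian v * maxwellian u := by
  have h := norm_sq_vPost_add_norm_sq_uPost v u ω
  have key : ∀ x y : R3, maxwellian x * maxwellian y =
      ((2 * Real.pi) ^ (3 / 2 : ℝ))⁻¹ ^ 2 * Real.exp (-(‖x‖ ^ 2 + ‖y‖ ^ 2) / 2) := fun x y => by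
    rw [neg_add, add_div, Real.exp_add, maxwellian, maxwellian]; ring
  rw [key, key, h]

@[fun_prop]
lemma continuous_vPost (v : R3) : Continuous fun p : R3 × S2 => vPost v p.1 p.2 := by
  unfold vPost; fun_prop

@[fun_prop]
lemma continuous_uPost (v : R3) : Continuous fun p : R3 × S2 => uPost v p.1 p.2 := by
  unfold uPost; fun_prop

/-! ### Moments of the collision kernel -/

instance isFiniteMeasure_surface : IsFiniteMeasure surface :=
  inferInstanceAs (IsFiniteMeasure (volume : Measure R3).toSphere)

lemma measurable_kernel_comp {θ : ℝ} {B : S2 → R3 → ℝ} (hB : IsCutoffKernel θ B) (v : R3) :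
    Measurable fun p : R3 × S2 => B p.2 (v - p.1) :=
  hB.measurable.comp (f := fun p : R3 × S2 => (p.2, v - p.1)) (by fun_prop)

lemma rpow_norm_sub_le {θ : ℝ} (hθ0 : 0 ≤ θ) (hθ1 : θ ≤ 1) (v u : R3) :
    ‖v - u‖ ^ θ ≤ 2 * (1 + ‖v‖ ^ 2) * (1 + ‖u‖ ^ 2) := by
  have h1 : ‖v - u‖ ^ θ ≤ 1 + ‖v - u‖ := by
    rcases le_total ‖v - u‖ 1 with h | h
    · exact (Real.rpow_le_one (norm_nonneg _) h hθ0).trans (by simp)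
    · calc ‖v - u‖ ^ θ ≤ ‖v - u‖ ^ (1 : ℝ) := Real.rpow_le_rpow_of_exponent_le h hθ1
        _ ≤ _ := by rw [Real.rpow_one]; linarith
  have h2 := norm_sub_le v u
  nlinarith [sq_nonneg (‖v‖ - 1), sq_nonneg (‖u‖ - 1), mul_nonneg (sq_nonneg ‖v‖) (sq_nonneg ‖u‖)]

/-- The kernel `B(ω, v - u) μ(u) (1 + |u|²)²`, which dominates the gain and the loss integrands of
fluid states. -/
noncomputable def kernelMoment (B : S2 → R3 → ℝ) (v : R3) (p : R3 × S2) : ℝ :=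
  B p.2 (v - p.1) * ((1 + ‖p.1‖ ^ 2) ^ 2 * maxwellian p.1)

lemma kernelMoment_nonneg {θ : ℝ} {B : S2 → R3 → ℝ} (hB : IsCutoffKernel θ B) (v : R3)
    (p : R3 × S2) : 0 ≤ kernelMoment B v p :=
  mul_nonneg (hB.nonneg _ _) (mul_nonneg (by positivity) (maxwellian_nonneg _))

lemma exists_integral_kernelMoment_le {θ : ℝ} (hθ0 : 0 ≤ θ) (hθ1 : θ ≤ 1) {B : S2 → R3 → ℝ}
    (hB : IsCutoffKernel θ B) : ∃ M : ℝ, 0 ≤ M ∧ ∀ v,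
      Integrable (kernelMoment B v) ((volume : Measure R3).prod surface) ∧
      ∫ p, kernelMoment B v p ∂((volume : Measure R3).prod surface) ≤ M * (1 + ‖v‖ ^ 2) := by
  obtain ⟨K, hK⟩ := hB.angular_bound
  have hI := integrable_one_add_sq_pow_mul_maxwellian 3
  have hI0 : 0 ≤ ∫ u : R3, (1 + ‖u‖ ^ 2) ^ 3 * maxwellian u :=
    integral_nonneg fun u => mul_nonneg (by positivity) (maxwellian_nonneg u)
  refine ⟨2 * |K| * ∫ u : R3, (1 + ‖u‖ ^ 2) ^ 3 * maxwellian u, by positivity, fun v => ?_⟩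
  have hmeas : Measurable (kernelMoment B v) :=
    (measurable_kernel_comp hB v).mul (by fun_prop)
  have hslice : ∀ u : R3, ∫⁻ ω, ENNReal.ofReal (kernelMoment B v (u, ω)) ∂surface ≤
      ENNReal.ofReal (2 * |K| * (1 + ‖v‖ ^ 2) * ((1 + ‖u‖ ^ 2) ^ 3 * maxwellian u)) := fun u => by
    have hw : 0 ≤ (1 + ‖u‖ ^ 2) ^ 2 * maxwellian u :=
      mul_nonneg (by positivity) (maxwellian_nonneg u)
    calc ∫⁻ ω, ENNReal.ofReal (kernelMoment B v (u, ω)) ∂surface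
        = ∫⁻ ω, ENNReal.ofReal (B ω (v - u)) *
            ENNReal.ofReal ((1 + ‖u‖ ^ 2) ^ 2 * maxwellian u) ∂surface := by
          simp only [kernelMoment, ENNReal.ofReal_mul (hB.nonneg _ _)]
      _ ≤ ENNReal.ofReal (K * ‖v - u‖ ^ θ) *
            ENNReal.ofReal ((1 + ‖u‖ ^ 2) ^ 2 * maxwellian u) := by
          rw [lintegral_mul_const' _ _ ENNReal.ofReal_ne_top]
          gcongr
          exact hK _
      _ ≤ ENNReal.ofReal (|K| * (2 * (1 + ‖v‖ ^ 2) * (1 + ‖u‖ ^ 2))) *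
            ENNReal.ofReal ((1 + ‖u‖ ^ 2) ^ 2 * maxwellian u) := by
          gcongr
          · exact le_abs_self K
          · exact rpow_norm_sub_le hθ0 hθ1 v u
      _ = _ := by
          rw [← ENNReal.ofReal_mul (by positivity)]
          congr 1
          ring
  have hlint : ∫⁻ p, ENNReal.ofReal (kernelMoment B v p) ∂((volume : Measure R3).prod surface) ≤
      ENNReal.ofReal ((2 * |K| * ∫ u : R3, (1 + ‖u‖ ^ 2) ^ 3 * maxwellian u) *
        (1 + ‖v‖ ^ 2)) := by
    calc ∫⁻ p, ENNReal.ofReal (kernelMoment B v p) ∂((volume : Measure R3).prod surface)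
        ≤ ∫⁻ u, ∫⁻ ω, ENNReal.ofReal (kernelMoment B v (u, ω)) ∂surface :=
          lintegral_prod_le _
      _ ≤ ∫⁻ u : R3, ENNReal.ofReal
            (2 * |K| * (1 + ‖v‖ ^ 2) * ((1 + ‖u‖ ^ 2) ^ 3 * maxwellian u)) :=
          lintegral_mono hslice
      _ = _ := by
          rw [← ofReal_integral_eq_lintegral_ofReal (hI.const_mul _)
            (Filter.Eventually.of_forall fun u => mul_nonneg (by positivity)
              (mul_nonneg (by positivity) (maxwellian_nonneg u))), integral_const_mul]
          congr 1
          ring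
  have hnn := Filter.Eventually.of_forall (f := ae ((volume : Measure R3).prod surface))
    (kernelMoment_nonneg hB v)
  refine ⟨⟨hmeas.aestronglyMeasurable, ?_⟩, ?_⟩
  · rw [hasFiniteIntegral_iff_ofReal hnn]
    exact hlint.trans_lt ENNReal.ofReal_lt_top
  · rw [integral_eq_lintegral_of_nonneg_ae hnn hmeas.aestronglyMeasurable]
    exact ENNReal.toReal_le_of_le_ofReal (by positivity) hlint

/-! ### Fluid states with constant coefficients -/

/-- The coefficients `(a, b, c)` of a fluid state at a point of space. The product carries the
sup norm, which is equivalent to any other. -/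
abbrev FluidCoeff : Type := ℝ × R3 × ℝ

/-- The polynomial `a + b · v + c (|v|² - 3)/2`. -/
noncomputable def fluidPoly (A : FluidCoeff) (v : R3) : ℝ :=
  A.1 + ⟪A.2.1, v⟫ + A.2.2 * ((‖v‖ ^ 2 - 3) / 2)

/-- The fluid state `√μ(v) [a + b · v + c (|v|² - 3)/2]`, a function of the velocity only. -/
noncomputable def fluidState (A : FluidCoeff) (v : R3) : ℝ := sqrtMax v * fluidPoly A v

@[fun_prop]
lemma continuous_fluidPoly (A : FluidCoeff) : Continuous (fluidPoly A) := by
  unfold fluidPoly; fun_prop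

lemma continuous_fluidState_prod :
    Continuous fun q : FluidCoeff × R3 => fluidState q.1 q.2 := by
  unfold fluidState fluidPoly; fun_prop

@[fun_prop]
lemma continuous_fluidState (A : FluidCoeff) : Continuous (fluidState A) := by
  unfold fluidState; fun_prop

lemma sqrtMax_mul_fluidState (A : FluidCoeff) (v : R3) :
    sqrtMax v * fluidState A v = maxwellian v * fluidPoly A v := by
  rw [fluidState, ← mul_assoc, sqrtMax_mul_self]

lemma abs_fluidPoly_le (A : FluidCoeff) (v : R3) :
    |fluidPoly A v| ≤ 3 * ‖A‖ * (1 + ‖v‖ ^ 2) := by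
  have ha : |A.1| ≤ ‖A‖ := norm_fst_le A
  have hb : ‖A.2.1‖ ≤ ‖A‖ := (norm_fst_le A.2).trans (norm_snd_le A)
  have hc : |A.2.2| ≤ ‖A‖ := (norm_snd_le A.2).trans (norm_snd_le A)
  have h1 : |⟪A.2.1, v⟫| ≤ ‖A‖ * ‖v‖ := (abs_real_inner_le_norm _ _).trans (by gcongr)
  have h2 : |A.2.2 * ((‖v‖ ^ 2 - 3) / 2)| ≤ ‖A‖ * ((‖v‖ ^ 2 + 3) / 2) := by
    rw [abs_mul]
    gcongr
    rw [abs_le]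
    constructor <;> nlinarith [sq_nonneg ‖v‖]
  calc |fluidPoly A v| ≤ |A.1| + |⟪A.2.1, v⟫| + |A.2.2 * ((‖v‖ ^ 2 - 3) / 2)| := abs_add_three _ _ _
    _ ≤ ‖A‖ + ‖A‖ * ‖v‖ + ‖A‖ * ((‖v‖ ^ 2 + 3) / 2) := by gcongr
    _ = ‖A‖ * (1 + ‖v‖ + (‖v‖ ^ 2 + 3) / 2) := by ring
    _ ≤ ‖A‖ * (3 * (1 + ‖v‖ ^ 2)) := by
        gcongr
        nlinarith [sq_nonneg (‖v‖ - 1), sq_nonneg ‖v‖]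
    _ = _ := by ring

lemma memLp_fluidState (A : FluidCoeff) {p : ℝ≥0∞} (hp0 : p ≠ 0) (hp : p ≠ ∞) :
    MemLp (fluidState A) p := by
  refine ((memLp_one_add_sq_pow_mul_sqrtMax 1 hp0 hp).const_mul (3 * ‖A‖)).mono'
    (by fun_prop) (Filter.Eventually.of_forall fun v => ?_)
  rw [fluidState, norm_mul, Real.norm_of_nonneg (sqrtMax_pos v).le, pow_one]
  calc sqrtMax v * ‖fluidPoly A v‖ ≤ sqrtMax v * (3 * ‖A‖ * (1 + ‖v‖ ^ 2)) :=
        mul_le_mul_of_nonneg_left (abs_fluidPoly_le A v) (sqrtMax_pos v).le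
    _ = _ := by ring

/-- A fluid state vanishes identically only if its coefficients do. -/
lemma eq_zero_of_fluidState_eq_zero {A : FluidCoeff} (h : ∀ v, fluidState A v = 0) : A = 0 := by
  have hP : ∀ v, fluidPoly A v = 0 := fun v =>
    (mul_eq_zero.1 (h v)).resolve_left (sqrtMax_pos v).ne'
  obtain ⟨a, b, c⟩ := A
  -- the odd part of the polynomial isolates `b`; its values at `0` and at a unit vector then
  -- determine `a` and `c`
  have hodd : ∀ v : R3, ⟪b, v⟫ = 0 := fun v => by
    have h1 := hP v
    have h2 := hP (-v)
    simp only [fluidPoly, inner_neg_right, norm_neg] at h1 h2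
    linarith
  have hb : b = 0 := inner_self_eq_zero.1 (hodd b)
  have h0 := hP 0
  have h1 := hP (EuclideanSpace.single 0 1)
  simp only [fluidPoly, hodd, norm_zero, PiLp.norm_single, norm_one] at h0 h1
  have hc : c = 0 := by linarith
  have ha : a = 0 := by subst hc; linarith
  simp [ha, hb, hc]

/-- The map sending coefficients to the corresponding fluid state in `L^p(ℝ³)`. -/
noncomputable def fluidStateLp (p : ℝ≥0∞) (hp0 : p ≠ 0) (hp : p ≠ ∞) :
    FluidCoeff →ₗ[ℝ] Lp ℝ p (volume : Measure R3) where
  toFun A := (memLp_fluidState A hp0 hp).toLp _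
  map_add' A A' := by
    rw [← MemLp.toLp_add]
    congr 1
    ext v
    simp only [fluidState, fluidPoly, Prod.fst_add, Prod.snd_add, inner_add_left, Pi.add_apply]
    ring
  map_smul' r A := by
    rw [RingHom.id_apply, ← MemLp.toLp_const_smul]
    congr 1
    ext v
    simp only [fluidState, fluidPoly, Prod.smul_fst, Prod.smul_snd, real_inner_smul_left,
      Pi.smul_apply, smul_eq_mul]
    ring

/-- On the finite-dimensional space of fluid states all norms are equivalent: the `L^p(dv)` norm
controls the coefficients. -/
lemma exists_enorm_le_eLpNorm_fluidState {p : ℝ≥0∞} (hp1 : 1 ≤ p) (hp : p ≠ ∞) :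
    ∃ K : ℝ≥0, ∀ A : FluidCoeff, ‖A‖ₑ ≤ K * eLpNorm (fluidState A) p volume := by
  have hp0 : p ≠ 0 := (zero_lt_one.trans_le hp1).ne'
  have : Fact (1 ≤ p) := ⟨hp1⟩
  obtain ⟨K, -, hK⟩ := (fluidStateLp p hp0 hp).exists_antilipschitzWith (by
    refine LinearMap.ker_eq_bot'.2 fun A hA => eq_zero_of_fluidState_eq_zero fun v => ?_
    have h0 : fluidState A =ᵐ[volume] fun _ => 0 :=
      (MemLp.coeFn_toLp (memLp_fluidState A hp0 hp)).symm.trans (by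
        change (memLp_fluidState A hp0 hp).toLp _ = 0 at hA
        rw [hA]
        exact Lp.coeFn_zero _ _ _)
    exact congrFun ((continuous_fluidState A).ae_eq_iff_eq volume continuous_const |>.1 h0) v)
  refine ⟨K, fun A => ?_⟩
  have h := hK A 0
  rw [map_zero, edist_zero_right, edist_zero_right] at h
  exact h.trans_eq (congrArg _ (Lp.enorm_toLp (memLp_fluidState A hp0 hp)))

/-! ### The collision operator on fluid states -/

lemma abs_gainIntegrand_le {θ : ℝ} {B : S2 → R3 → ℝ} (hB : IsCutoffKernel θ B)
    (A G : FluidCoeff) (v : R3) (p : R3 × S2) :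
    |gainIntegrand B (fun w => sqrtMax w * fluidState A w) (fun w => sqrtMax w * fluidState G w)
      v p| ≤ 9 * ‖A‖ * ‖G‖ * ((1 + ‖v‖ ^ 2) ^ 2 * maxwellian v) * kernelMoment B v p := by
  have hE := norm_sq_vPost_add_norm_sq_uPost v p.1 p.2
  have hM := maxwellian_vPost_mul_uPost v p.1 p.2
  simp only [gainIntegrand, sqrtMax_mul_fluidState, kernelMoment]
  set v' := vPost v p.1 p.2
  set u' := uPost v p.1 p.2
  have hB0 := hB.nonneg p.2 (v - p.1)
  have hle : (1 + ‖v'‖ ^ 2) * (1 + ‖u'‖ ^ 2) ≤ (1 + ‖v‖ ^ 2) ^ 2 * (1 + ‖p.1‖ ^ 2) ^ 2 := by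
    have h1 : (1 + ‖v'‖ ^ 2) * (1 + ‖u'‖ ^ 2) ≤ (1 + (‖v‖ ^ 2 + ‖p.1‖ ^ 2)) ^ 2 := by
      rw [sq (1 + _), ← hE]
      gcongr <;> nlinarith [sq_nonneg ‖v'‖, sq_nonneg ‖u'‖]
    refine h1.trans ?_
    rw [← mul_pow]
    gcongr
    nlinarith [mul_nonneg (sq_nonneg ‖v‖) (sq_nonneg ‖p.1‖)]
  have hμ : 0 ≤ maxwellian v * maxwellian p.1 :=
    mul_nonneg (maxwellian_nonneg _) (maxwellian_nonneg _)
  calc |B p.2 (v - p.1) * (maxwellian v' * fluidPoly A v') * (maxwellian u' * fluidPoly G u')|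
      = B p.2 (v - p.1) * (maxwellian v' * maxwellian u') *
          (|fluidPoly A v'| * |fluidPoly G u'|) := by
        simp only [abs_mul, abs_of_nonneg hB0, abs_of_nonneg (maxwellian_nonneg _)]; ring
    _ ≤ B p.2 (v - p.1) * (maxwellian v * maxwellian p.1) *
          ((3 * ‖A‖ * (1 + ‖v'‖ ^ 2)) * (3 * ‖G‖ * (1 + ‖u'‖ ^ 2))) := by
        rw [hM]
        gcongr
        · exact abs_fluidPoly_le A v'
        · exact abs_fluidPoly_le G u'
    _ = B p.2 (v - p.1) * (maxwellian v * maxwellian p.1) *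
          (9 * ‖A‖ * ‖G‖ * ((1 + ‖v'‖ ^ 2) * (1 + ‖u'‖ ^ 2))) := by ring
    _ ≤ B p.2 (v - p.1) * (maxwellian v * maxwellian p.1) *
          (9 * ‖A‖ * ‖G‖ * ((1 + ‖v‖ ^ 2) ^ 2 * (1 + ‖p.1‖ ^ 2) ^ 2)) := by gcongr
    _ = _ := by ring

lemma abs_lossIntegrand_le {θ : ℝ} {B : S2 → R3 → ℝ} (hB : IsCutoffKernel θ B)
    (G : FluidCoeff) (v : R3) (p : R3 × S2) :
    |lossIntegrand B (fun w => sqrtMax w * fluidState G w) v p| ≤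
      3 * ‖G‖ * kernelMoment B v p := by
  have hB0 := hB.nonneg p.2 (v - p.1)
  have hμ := maxwellian_nonneg p.1
  simp only [lossIntegrand, sqrtMax_mul_fluidState, kernelMoment, abs_mul, abs_of_nonneg hB0,
    abs_of_nonneg hμ]
  calc B p.2 (v - p.1) * (maxwellian p.1 * |fluidPoly G p.1|)
      ≤ B p.2 (v - p.1) * (maxwellian p.1 * (3 * ‖G‖ * (1 + ‖p.1‖ ^ 2) ^ 2)) := by
        gcongr
        refine (abs_fluidPoly_le G p.1).trans ?_
        gcongr
        nlinarith [sq_nonneg ‖p.1‖, sq_nonneg (‖p.1‖ ^ 2)]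
    _ = _ := by ring

lemma measurable_gainIntegrand {θ : ℝ} {B : S2 → R3 → ℝ} (hB : IsCutoffKernel θ B)
    {F G : R3 → ℝ} (hF : Continuous F) (hG : Continuous G) (v : R3) :
    Measurable (gainIntegrand B F G v) :=
  ((measurable_kernel_comp hB v).mul (hF.comp (continuous_vPost v)).measurable).mul
    (hG.comp (continuous_uPost v)).measurable

lemma measurable_lossIntegrand {θ : ℝ} {B : S2 → R3 → ℝ} (hB : IsCutoffKernel θ B)
    {G : R3 → ℝ} (hG : Continuous G) (v : R3) : Measurable (lossIntegrand B G v) :=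
  (measurable_kernel_comp hB v).mul (hG.comp continuous_fst).measurable

lemma nlCollisionConverges_fluidState {θ : ℝ} (hθ0 : 0 ≤ θ) (hθ1 : θ ≤ 1) {B : S2 → R3 → ℝ}
    (hB : IsCutoffKernel θ B) (A G : FluidCoeff) (v : R3) :
    NlCollisionConverges B (fluidState A) (fluidState G) v := by
  obtain ⟨M, -, hM⟩ := exists_integral_kernelMoment_le hθ0 hθ1 hB
  refine ⟨((hM v).1.const_mul _).mono'
      (measurable_gainIntegrand hB (by fun_prop) (by fun_prop) v).aestronglyMeasurable
      (Filter.Eventually.of_forall (abs_gainIntegrand_le hB A G v)),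
    ((hM v).1.const_mul _).mono'
      (measurable_lossIntegrand hB (by fun_prop) v).aestronglyMeasurable
      (Filter.Eventually.of_forall (abs_lossIntegrand_le hB G v))⟩

/-- The collision operator is bounded on fluid states, with Gaussian decay in the velocity. -/
lemma exists_abs_nlCollision_fluidState_le {θ : ℝ} (hθ0 : 0 ≤ θ) (hθ1 : θ ≤ 1)
    {B : S2 → R3 → ℝ} (hB : IsCutoffKernel θ B) : ∃ M : ℝ, 0 ≤ M ∧ ∀ A G v,
      |nlCollision B (fluidState A) (fluidState G) v| ≤
        ‖A‖ * ‖G‖ * (M * ((1 + ‖v‖ ^ 2) ^ 3 * sqrtMax v)) := by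
  obtain ⟨M, hM0, hM⟩ := exists_integral_kernelMoment_le hθ0 hθ1 hB
  refine ⟨18 * M, by positivity, fun A G v => ?_⟩
  obtain ⟨hint, hle⟩ := hM v
  have hμ := maxwellian_nonneg v
  have hs := sqrtMax_pos v
  have hgain : |gain B (fun w => sqrtMax w * fluidState A w)
      (fun w => sqrtMax w * fluidState G w) v| ≤
      9 * ‖A‖ * ‖G‖ * ((1 + ‖v‖ ^ 2) ^ 2 * maxwellian v) * (M * (1 + ‖v‖ ^ 2)) := by
    refine (norm_integral_le_of_norm_le (f := gainIntegrand B _ _ v) (hint.const_mul _)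
      (Filter.Eventually.of_forall (abs_gainIntegrand_le hB A G v))).trans ?_
    rw [integral_const_mul]
    gcongr
  have hlossInt : |∫ p, lossIntegrand B (fun w => sqrtMax w * fluidState G w) v p
      ∂((volume : Measure R3).prod surface)| ≤ 3 * ‖G‖ * (M * (1 + ‖v‖ ^ 2)) := by
    refine (norm_integral_le_of_norm_le (f := lossIntegrand B _ v) (hint.const_mul _)
      (Filter.Eventually.of_forall (abs_lossIntegrand_le hB G v))).trans ?_
    rw [integral_const_mul]
    gcongr
  have hloss : |loss B (fun w => sqrtMax w * fluidState A w)
      (fun w => sqrtMax w * fluidState G w) v| ≤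
      maxwellian v * (3 * ‖A‖ * (1 + ‖v‖ ^ 2)) * (3 * ‖G‖ * (M * (1 + ‖v‖ ^ 2))) := by
    rw [loss, sqrtMax_mul_fluidState, abs_mul, abs_mul, abs_of_nonneg hμ]
    gcongr
    exact abs_fluidPoly_le A v
  have hcube : (1 + ‖v‖ ^ 2) * (1 + ‖v‖ ^ 2) ≤ (1 + ‖v‖ ^ 2) ^ 3 := by
    rw [← sq]
    exact pow_le_pow_right₀ (by nlinarith [sq_nonneg ‖v‖]) (by norm_num)
  have hsub := abs_sub (gain B (fun w => sqrtMax w * fluidState A w)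
    (fun w => sqrtMax w * fluidState G w) v) (loss B (fun w => sqrtMax w * fluidState A w)
    (fun w => sqrtMax w * fluidState G w) v)
  rw [nlCollision, collision, abs_mul, abs_of_pos (inv_pos.2 hs), inv_mul_le_iff₀ hs]
  calc _ ≤ _ := hsub
    _ ≤ _ := add_le_add hgain hloss
    _ = 9 * ‖A‖ * ‖G‖ * M * maxwellian v *
          ((1 + ‖v‖ ^ 2) ^ 3 + (1 + ‖v‖ ^ 2) * (1 + ‖v‖ ^ 2)) := by ring
    _ ≤ 9 * ‖A‖ * ‖G‖ * M * maxwellian v * ((1 + ‖v‖ ^ 2) ^ 3 + (1 + ‖v‖ ^ 2) ^ 3) := by gcongr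
    _ = _ := by rw [← sqrtMax_mul_self]; ring

/-- Momentum and energy are collisional invariants. -/
lemma fluidPoly_vPost_add_fluidPoly_uPost (A : FluidCoeff) (v u : R3) (ω : S2) :
    fluidPoly A (vPost v u ω) + fluidPoly A (uPost v u ω) = fluidPoly A v + fluidPoly A u := by
  have h1 : ⟪A.2.1, vPost v u ω⟫ + ⟪A.2.1, uPost v u ω⟫ = ⟪A.2.1, v⟫ + ⟪A.2.1, u⟫ := by
    rw [← inner_add_right, vPost_add_uPost, inner_add_right]
  have h2 := norm_sq_vPost_add_norm_sq_uPost v u ω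
  simp only [fluidPoly]
  linear_combination h1 + A.2.2 / 2 * h2

/-- The symmetrized collision of a multiple of `√μ` with a fluid state vanishes: gain and loss
integrands agree pointwise because `1`, `v`, `|v|²` are collisional invariants. -/
lemma nlCollision_sqrtMax_add_nlCollision_sqrtMax {θ : ℝ} (hθ0 : 0 ≤ θ) (hθ1 : θ ≤ 1)
    {B : S2 → R3 → ℝ} (hB : IsCutoffKernel θ B) (d : ℝ) (G : FluidCoeff) (v : R3) :
    nlCollision B (fun w => sqrtMax w * d) (fluidState G) v +
      nlCollision B (fluidState G) (fun w => sqrtMax w * d) v = 0 := by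
  have hd : (fun w => sqrtMax w * d) = fluidState (d, 0, 0) := by
    ext w; simp [fluidState, fluidPoly]
  have hpd : ∀ w, fluidPoly (d, 0, 0) w = d := fun w => by simp [fluidPoly]
  rw [hd]
  obtain ⟨hg1, hl1⟩ := nlCollisionConverges_fluidState hθ0 hθ1 hB (d, 0, 0) G v
  obtain ⟨hg2, hl2⟩ := nlCollisionConverges_fluidState hθ0 hθ1 hB G (d, 0, 0) v
  rw [nlCollision, nlCollision, ← mul_add]
  refine mul_eq_zero_of_right _ ?_
  simp only [collision, gain, loss]
  rw [sub_add_sub_comm, sub_eq_zero, ← integral_add hg1 hg2, ← integral_const_mul,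
    ← integral_const_mul, ← integral_add (hl1.const_mul _) (hl2.const_mul _)]
  refine integral_congr_ae (Filter.Eventually.of_forall fun p => ?_)
  have hP := fluidPoly_vPost_add_fluidPoly_uPost G v p.1 p.2
  have hM := maxwellian_vPost_mul_uPost v p.1 p.2
  simp only [gainIntegrand, lossIntegrand, sqrtMax_mul_fluidState, hpd]
  linear_combination B p.2 (v - p.1) * d * (fluidPoly G v + fluidPoly G p.1) * hM +
    B p.2 (v - p.1) * d * maxwellian (vPost v p.1 p.2) * maxwellian (uPost v p.1 p.2) * hP

/-! ### Norms in space and velocity -/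

/-- The `L²` norm of a tensor product. -/
lemma eLpNorm_two_mul_prod {ν : Measure R3} [SFinite ν] {α w : R3 → ℝ}
    (hα : AEStronglyMeasurable α ν) (hw : AEStronglyMeasurable w) :
    eLpNorm (fun z : R3 × R3 => α z.1 * w z.2) 2 (ν.prod volume) =
      eLpNorm α 2 ν * eLpNorm w 2 volume := by
  simp only [eLpNorm_eq_lintegral_rpow_enorm_toReal two_ne_zero ENNReal.ofNat_ne_top, enorm_mul,
    ENNReal.mul_rpow_of_nonneg _ _ ENNReal.toReal_nonneg]
  rw [lintegral_prod_mul (hα.enorm.pow_const _) (hw.enorm.pow_const _),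
    ENNReal.mul_rpow_of_nonneg _ _ (by positivity)]

/-- The `L^p` norm of a fluid state in space and velocity controls the `L^p` norm of its
coefficients in space. -/
lemma exists_eLpNorm_coeff_le {p : ℝ≥0∞} (hp1 : 1 ≤ p) (hp : p ≠ ∞) :
    ∃ K : ℝ≥0, ∀ (ν : Measure R3) [SFinite ν] (A : R3 → FluidCoeff), AEStronglyMeasurable A ν →
      eLpNorm A p ν ≤
        K * eLpNorm (fun z : R3 × R3 => fluidState (A z.1) z.2) p (ν.prod volume) := by
  obtain ⟨K, hK⟩ := exists_enorm_le_eLpNorm_fluidState hp1 hp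
  have hp0 : p ≠ 0 := (zero_lt_one.trans_le hp1).ne'
  have hpr : 0 < p.toReal := ENNReal.toReal_pos hp0 hp
  refine ⟨K, fun ν _ A hA => ?_⟩
  have hmeas : AEStronglyMeasurable (fun z : R3 × R3 => fluidState (A z.1) z.2)
      (ν.prod volume) := by
    have h := hA.comp_fst (ν := (volume : Measure R3)) |>.prodMk measurable_snd.aestronglyMeasurable
    have h' := Continuous.comp_aestronglyMeasurable continuous_fluidState_prod h
    exact h'
  simp only [eLpNorm_eq_lintegral_rpow_enorm_toReal hp0 hp] at hK ⊢
  rw [lintegral_prod _ (hmeas.enorm.pow_const _)]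
  have hKp : (K : ℝ≥0∞) = ((K : ℝ≥0∞) ^ p.toReal) ^ (1 / p.toReal) := by
    rw [← ENNReal.rpow_mul, mul_one_div_cancel hpr.ne', ENNReal.rpow_one]
  conv_rhs => rw [hKp]
  rw [← ENNReal.mul_rpow_of_nonneg _ _ (by positivity),
    ← lintegral_const_mul' _ _ (ENNReal.rpow_ne_top_of_nonneg hpr.le ENNReal.coe_ne_top)]
  gcongr with x
  refine (ENNReal.rpow_le_rpow (hK (A x)) hpr.le).trans_eq ?_
  rw [ENNReal.mul_rpow_of_nonneg _ _ hpr.le, ← ENNReal.rpow_mul, one_div_mul_cancel hpr.ne',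
    ENNReal.rpow_one]

/-- `‖β‖₃ ≤ ‖β‖_∞^{1/3} ‖β‖₂^{2/3}`. -/
lemma eLpNorm_three_le_of_enorm_le {X E : Type*} [MeasurableSpace X] {ν : Measure X}
    [NormedAddCommGroup E] {β : X → E} (hβ : AEStronglyMeasurable β ν) {N : ℝ≥0∞}
    (hN : ∀ᵐ x ∂ν, ‖β x‖ₑ ≤ N) :
    eLpNorm β 3 ν ≤ N ^ (1 / 3 : ℝ) * eLpNorm β 2 ν ^ (2 / 3 : ℝ) := by
  simp only [eLpNorm_eq_lintegral_rpow_enorm_toReal two_ne_zero ENNReal.ofNat_ne_top,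
    eLpNorm_eq_lintegral_rpow_enorm_toReal three_ne_zero ENNReal.ofNat_ne_top,
    ENNReal.toReal_ofNat]
  rw [← ENNReal.rpow_mul, show (1 / 2 * (2 / 3) : ℝ) = 1 / 3 by norm_num,
    ← ENNReal.mul_rpow_of_nonneg _ _ (by norm_num),
    ← lintegral_const_mul'' _ (hβ.enorm.pow_const _)]
  refine ENNReal.rpow_le_rpow (lintegral_mono_ae ?_) (by norm_num)
  filter_upwards [hN] with x hx
  rw [show (3 : ℝ) = 1 + 2 by norm_num, ENNReal.rpow_add_of_nonneg _ _ (by norm_num) (by norm_num),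
    ENNReal.rpow_one]
  gcongr

instance holderTriple_six_three_two : ENNReal.HolderTriple 6 3 2 where
  inv_add_inv_eq_inv := by
    rw [← ENNReal.toReal_eq_toReal_iff' (by simp) (by simp), ENNReal.toReal_add (by simp) (by simp)]
    norm_num

/-- Hölder's inequality with `1/6 + 1/3 = 1/2`, the `L³` norm being interpolated. -/
lemma eLpNorm_mul_norm_le_six {X E : Type*} [MeasurableSpace X] {ν : Measure X}
    [NormedAddCommGroup E] {α β : X → E} (hα : AEStronglyMeasurable α ν)
    (hβ : AEStronglyMeasurable β ν) {N : ℝ≥0∞} (hN : ∀ᵐ x ∂ν, ‖β x‖ₑ ≤ N) :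
    eLpNorm (fun x => ‖α x‖ * ‖β x‖) 2 ν ≤
      eLpNorm α 6 ν * (N ^ (1 / 3 : ℝ) * eLpNorm β 2 ν ^ (2 / 3 : ℝ)) := by
  have h := eLpNorm_le_eLpNorm_mul_eLpNorm_of_nnnorm (p := 6) (q := 3) (r := 2) hα hβ
    (fun x y => ‖x‖ * ‖y‖) 1 (Filter.Eventually.of_forall fun x => by simp)
  rw [ENNReal.coe_one, one_mul] at h
  exact h.trans (by gcongr; exact eLpNorm_three_le_of_enorm_le hβ hN)

lemma eLpNorm_mul_norm_le_top {X E : Type*} [MeasurableSpace X] {ν : Measure X}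
    [NormedAddCommGroup E] {α β : X → E} (hα : AEStronglyMeasurable α ν) {N : ℝ≥0∞}
    (hN : ∀ᵐ x ∂ν, ‖β x‖ₑ ≤ N) :
    eLpNorm (fun x => ‖α x‖ * ‖β x‖) 2 ν ≤ eLpNorm α 2 ν * N := by
  have h := eLpNorm_le_eLpNorm_mul_eLpNorm_top 2 hα β (fun x y => ‖x‖ * ‖y‖) 1
    (Filter.Eventually.of_forall fun x => by simp)
  rw [ENNReal.coe_one, one_mul] at h
  refine h.trans ?_
  gcongr
  rw [eLpNorm_exponent_top]
  exact essSup_le_of_ae_le _ hN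

/-! ### The coefficients of the fluid part -/

/-- The coefficients `(a_f, b_f, c_f)` of the fluid part of `f`. -/
noncomputable def coeffOf (f : R3 → R3 → ℝ) (x : R3) : FluidCoeff :=
  (densityOf f x, velocityOf f x, temperatureOf f x)

lemma aestronglyMeasurable_coeffOf {Ω : Set R3} {f : R3 → R3 → ℝ} (hf : IsPhaseFunction Ω f) :
    AEStronglyMeasurable (coeffOf f) (volume.restrict (exterior Ω)) := by
  have hf' : AEStronglyMeasurable (fun z : R3 × R3 => f z.1 z.2)
    (((volume : Measure R3).restrict (exterior Ω)).prod volume) := hf.measurable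
  have hs : AEStronglyMeasurable (fun z : R3 × R3 => sqrtMax z.2)
      (((volume : Measure R3).restrict (exterior Ω)).prod volume) :=
    Continuous.aestronglyMeasurable (by fun_prop)
  have hv : AEStronglyMeasurable (fun z : R3 × R3 => z.2)
      (((volume : Measure R3).restrict (exterior Ω)).prod volume) :=
    Continuous.aestronglyMeasurable (by fun_prop)
  have ht : AEStronglyMeasurable (fun z : R3 × R3 => (‖z.2‖ ^ 2 - 3) / 3)
      (((volume : Measure R3).restrict (exterior Ω)).prod volume) :=
    Continuous.aestronglyMeasurable (by fun_prop)
  exact ((hf'.mul hs).integral_prod_right').prodMk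
    (((hf'.mul hs).smul hv).integral_prod_right'.prodMk
      ((hf'.mul ht).mul hs).integral_prod_right')

/-- The coefficients of the fluid part are bounded by the `L^∞` norm. -/
lemma exists_enorm_coeffOf_le : ∃ K : ℝ≥0, ∀ (Ω : Set R3) (g : R3 → R3 → ℝ),
    ∀ᵐ x ∂(volume : Measure R3).restrict (exterior Ω),
      ‖coeffOf g x‖ₑ ≤ K * phaseNorm Ω ∞ g := by
  set w : R3 → ℝ := fun v => (1 + ‖v‖ ^ 2) * sqrtMax v
  have hwint : Integrable w := by
    simpa only [pow_one] using memLp_one_iff_integrable.1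
      (memLp_one_add_sq_pow_mul_sqrtMax 1 one_ne_zero ENNReal.one_ne_top)
  have hfin : ∫⁻ v, ‖w v‖ₑ ≠ ∞ := hwint.2.ne
  refine ⟨(∫⁻ v, ‖w v‖ₑ).toNNReal, fun Ω g => ?_⟩
  rw [ENNReal.coe_toNNReal hfin]
  have hae : ∀ᵐ z ∂phaseMeasure Ω, ‖Function.uncurry g z‖ₑ ≤ phaseNorm Ω ∞ g := by
    rw [phaseNorm, eLpNorm_exponent_top]
    exact ae_le_essSup
  filter_upwards [Measure.ae_ae_of_ae_prod hae] with x hx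
  -- each coefficient integrates `g(x, ·)` against a weight of size at most `w`
  have key : ∀ {E : Type} [NormedAddCommGroup E] [NormedSpace ℝ E] (h : R3 → E),
      (∀ v, ‖h v‖ ≤ ‖g x v‖ * ‖w v‖) →
        ‖∫ v, h v‖ₑ ≤ (∫⁻ v, ‖w v‖ₑ) * phaseNorm Ω ∞ g := by
    intro E _ _ h hh
    calc ‖∫ v, h v‖ₑ ≤ ∫⁻ v, ‖h v‖ₑ := enorm_integral_le_lintegral_enorm _
      _ ≤ ∫⁻ v, ‖w v‖ₑ * phaseNorm Ω ∞ g := by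
          refine lintegral_mono_ae ?_
          filter_upwards [hx] with v hv
          have h1 : ‖h v‖ₑ ≤ ‖g x v‖ₑ * ‖w v‖ₑ := by
            rw [← enorm_mul, enorm_le_iff_norm_le, norm_mul]
            exact hh v
          rw [mul_comm ‖w v‖ₑ]
          exact h1.trans (by gcongr; exact hv)
      _ = _ := lintegral_mul_const'' _ hwint.1.enorm
  have hwn : ∀ v, ‖w v‖ = (1 + ‖v‖ ^ 2) * sqrtMax v := fun v =>
    Real.norm_of_nonneg (mul_nonneg (by positivity) (sqrtMax_pos v).le)
  have hsn : ∀ v, ‖sqrtMax v‖ = sqrtMax v := fun v => Real.norm_of_nonneg (sqrtMax_pos v).le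
  have hs0 := fun v => (sqrtMax_pos v).le
  have hd : ‖densityOf g x‖ₑ ≤ (∫⁻ v, ‖w v‖ₑ) * phaseNorm Ω ∞ g := key _ fun v => by
    rw [norm_mul, hwn, hsn]
    have := hs0 v
    gcongr
    nlinarith [mul_nonneg (sq_nonneg ‖v‖) this]
  have hb : ‖velocityOf g x‖ₑ ≤ (∫⁻ v, ‖w v‖ₑ) * phaseNorm Ω ∞ g := key _ fun v => by
    rw [norm_smul, norm_mul, hwn, hsn, mul_assoc, mul_comm (sqrtMax v)]
    have := hs0 v
    gcongr
    nlinarith [sq_nonneg (‖v‖ - 1)]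
  have hc : ‖temperatureOf g x‖ₑ ≤ (∫⁻ v, ‖w v‖ₑ) * phaseNorm Ω ∞ g := key _ fun v => by
    rw [norm_mul, norm_mul, hwn, hsn, mul_assoc]
    have := hs0 v
    gcongr
    rw [Real.norm_eq_abs, abs_le]
    constructor <;> nlinarith [sq_nonneg ‖v‖]
  have hmax : ∀ {E F : Type} [NormedAddCommGroup E] [NormedAddCommGroup F] (y : E × F),
      ‖y‖ₑ = max ‖y.1‖ₑ ‖y.2‖ₑ := fun y => by
    simp only [enorm, Prod.nnnorm_def, ENNReal.coe_max]
  rw [hmax, hmax]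
  exact max_le hd (max_le hb hc)

/-! ### Estimates of the collision operator in space and velocity -/

/-- The collision of two fluid states with coefficients `A`, `G` depending on `x` is controlled by
the `L²` norm of `|A| |G|` in space alone. -/
lemma exists_eLpNorm_nlCollision_le {θ : ℝ} (hθ0 : 0 ≤ θ) (hθ1 : θ ≤ 1) {B : S2 → R3 → ℝ}
    (hB : IsCutoffKernel θ B) : ∃ W : ℝ≥0, ∀ (ν : Measure R3) [SFinite ν] (A G : R3 → FluidCoeff),
      AEStronglyMeasurable A ν → AEStronglyMeasurable G ν →
      eLpNorm (fun z : R3 × R3 => nlCollision B (fluidState (A z.1)) (fluidState (G z.1)) z.2) 2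
        (ν.prod volume) ≤ W * eLpNorm (fun x => ‖A x‖ * ‖G x‖) 2 ν := by
  obtain ⟨M, -, hM⟩ := exists_abs_nlCollision_fluidState_le hθ0 hθ1 hB
  have hw : MemLp (fun v : R3 => M * ((1 + ‖v‖ ^ 2) ^ 3 * sqrtMax v)) 2 :=
    (memLp_one_add_sq_pow_mul_sqrtMax 3 two_ne_zero ENNReal.ofNat_ne_top).const_mul M
  refine ⟨(eLpNorm (fun v : R3 => M * ((1 + ‖v‖ ^ 2) ^ 3 * sqrtMax v)) 2 volume).toNNReal,
    fun ν _ A G hA hG => ?_⟩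
  rw [ENNReal.coe_toNNReal hw.2.ne, mul_comm,
    ← eLpNorm_two_mul_prod (α := fun x => ‖A x‖ * ‖G x‖) (hA.norm.mul hG.norm) hw.1]
  exact eLpNorm_mono_real fun z => hM (A z.1) (G z.1) z.2

/-- Hölder's inequality for a fluid part split into an `L⁶` and an `L²` summand. -/
lemma eLpNorm_mul_norm_le_of_splitting {X E : Type*} [MeasurableSpace X] {ν : Measure X}
    [NormedAddCommGroup E] {F G A₁ A₂ : X → E} (hG : AEStronglyMeasurable G ν)
    (hA₁ : AEStronglyMeasurable A₁ ν) (hA₂ : AEStronglyMeasurable A₂ ν)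
    (hsum : ∀ᵐ x ∂ν, F x = A₁ x + A₂ x) {N : ℝ≥0∞} (hN : ∀ᵐ x ∂ν, ‖G x‖ₑ ≤ N) :
    eLpNorm (fun x => ‖F x‖ * ‖G x‖) 2 ν ≤
      eLpNorm A₁ 6 ν * (N ^ (1 / 3 : ℝ) * eLpNorm G 2 ν ^ (2 / 3 : ℝ)) + eLpNorm A₂ 2 ν * N := by
  calc eLpNorm (fun x => ‖F x‖ * ‖G x‖) 2 ν
      ≤ eLpNorm ((fun x => ‖A₁ x‖ * ‖G x‖) + fun x => ‖A₂ x‖ * ‖G x‖) 2 ν := by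
        refine eLpNorm_mono_ae_real ?_
        filter_upwards [hsum] with x hx
        rw [hx, Real.norm_of_nonneg (by positivity), Pi.add_apply, ← add_mul]
        gcongr
        exact norm_add_le _ _
    _ ≤ eLpNorm (fun x => ‖A₁ x‖ * ‖G x‖) 2 ν + eLpNorm (fun x => ‖A₂ x‖ * ‖G x‖) 2 ν :=
        eLpNorm_add_le (hA₁.norm.mul hG.norm) (hA₂.norm.mul hG.norm) (by norm_num)
    _ ≤ _ := add_le_add (eLpNorm_mul_norm_le_six hA₁ hG hN) (eLpNorm_mul_norm_le_top hA₂ hN)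

lemma splitting_bound_le (K₂ K₆ K : ℝ≥0) {x₁ x₂ y s₁ s₂ P N : ℝ≥0∞} (h₁ : x₁ ≤ K₆ * s₁)
    (h₂ : x₂ ≤ K₂ * s₂) (hy : y ≤ K₂ * P) :
    x₁ * ((K * N) ^ (1 / 3 : ℝ) * y ^ (2 / 3 : ℝ)) + x₂ * (K * N) ≤
      (K₆ * K ^ (1 / 3 : ℝ) * K₂ ^ (2 / 3 : ℝ) + K₂ * K : ℝ≥0) *
        (s₁ * P ^ (2 / 3 : ℝ) * N ^ (1 / 3 : ℝ) + s₂ * N) := by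
  set c : ℝ≥0 := K₆ * K ^ (1 / 3 : ℝ) * K₂ ^ (2 / 3 : ℝ) with hc
  calc x₁ * ((K * N) ^ (1 / 3 : ℝ) * y ^ (2 / 3 : ℝ)) + x₂ * (K * N)
      ≤ K₆ * s₁ * ((K * N) ^ (1 / 3 : ℝ) * (K₂ * P) ^ (2 / 3 : ℝ)) + K₂ * s₂ * (K * N) := by
        gcongr
    _ = c * (s₁ * P ^ (2 / 3 : ℝ) * N ^ (1 / 3 : ℝ)) + (K₂ * K : ℝ≥0) * (s₂ * N) := by
        rw [ENNReal.mul_rpow_of_nonneg _ _ (by norm_num),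
          ENNReal.mul_rpow_of_nonneg _ _ (by norm_num), hc]
        push_cast
        rw [ENNReal.coe_rpow_of_nonneg _ (by norm_num), ENNReal.coe_rpow_of_nonneg _ (by norm_num)]
        ring
    _ ≤ (c + K₂ * K : ℝ≥0) * (s₁ * P ^ (2 / 3 : ℝ) * N ^ (1 / 3 : ℝ)) +
          (c + K₂ * K : ℝ≥0) * (s₂ * N) := by
        gcongr
        · exact le_self_add
        · exact le_add_self
    _ = _ := (mul_add _ _ _).symm

end Boltzmann

theorem mainTheorem7 (θ : ℝ) (hθ0 : 0 ≤ θ) (hθ1 : θ ≤ 1) (B : S2 → R3 → ℝ)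
    (hB : IsCutoffKernel θ B) :
    ∃ C : ℝ≥0, ∀ (Ω : Set R3) (f g : R3 → R3 → ℝ),
      IsPhaseFunction Ω f → IsPhaseFunction Ω g →
      -- the collision integrals converge absolutely
      (∀ x v, NlCollisionConverges B (fluidProj f x) (fluidProj g x) v ∧
        NlCollisionConverges B (fluidProj g x) (fluidProj f x) v) ∧
      -- the estimate, for every splitting of the fluid part of `f`
      (∀ (a₁ : R3 → ℝ) (b₁ : R3 → R3) (c₁ : R3 → ℝ)
          (a₂ : R3 → ℝ) (b₂ : R3 → R3) (c₂ : R3 → ℝ),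
        IsFluidSplitting Ω f a₁ b₁ c₁ a₂ b₂ c₂ →
        phaseNorm Ω 2 (fun x => nlCollision B (fluidProj f x) (fluidProj g x)) +
            phaseNorm Ω 2 (fun x => nlCollision B (fluidProj g x) (fluidProj f x)) ≤
          C * (phaseNorm Ω 6 (fluid a₁ b₁ c₁) *
                phaseNorm Ω 2 (fluidProj g) ^ (2 / 3 : ℝ) * phaseNorm Ω ∞ g ^ (1 / 3 : ℝ) +
              phaseNorm Ω 2 (fluid a₂ b₂ c₂) * phaseNorm Ω ∞ g)) ∧
      -- the density component of `f` does not contribute to `Γ(Pf, Pg) + Γ(Pg, Pf)`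
      (∀ x v,
        nlCollision B (fun w => sqrtMax w * densityOf f x) (fluidProj g x) v +
          nlCollision B (fluidProj g x) (fun w => sqrtMax w * densityOf f x) v = 0) := by
  obtain ⟨W, hW⟩ := exists_eLpNorm_nlCollision_le hθ0 hθ1 hB
  obtain ⟨K₂, hK₂⟩ := exists_eLpNorm_coeff_le (p := 2) (by norm_num) ENNReal.ofNat_ne_top
  obtain ⟨K₆, hK₆⟩ := exists_eLpNorm_coeff_le (p := 6) (by norm_num) ENNReal.ofNat_ne_top
  obtain ⟨K, hK⟩ := exists_enorm_coeffOf_le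
  refine ⟨2 * W * (K₆ * K ^ (1 / 3 : ℝ) * K₂ ^ (2 / 3 : ℝ) + K₂ * K), fun Ω f g hf hg => ⟨fun x v =>
    ⟨nlCollisionConverges_fluidState hθ0 hθ1 hB (coeffOf f x) (coeffOf g x) v,
      nlCollisionConverges_fluidState hθ0 hθ1 hB (coeffOf g x) (coeffOf f x) v⟩, ?_, fun x v =>
    nlCollision_sqrtMax_add_nlCollision_sqrtMax hθ0 hθ1 hB (densityOf f x) (coeffOf g x) v⟩⟩
  intro a₁ b₁ c₁ a₂ b₂ c₂ hS
  set ν : Measure R3 := (volume : Measure R3).restrict (exterior Ω)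
  set A₁ : R3 → FluidCoeff := fun x => (a₁ x, b₁ x, c₁ x)
  set A₂ : R3 → FluidCoeff := fun x => (a₂ x, b₂ x, c₂ x)
  have hA₁ : AEStronglyMeasurable A₁ ν :=
    hS.measurable_a₁.prodMk (hS.measurable_b₁.prodMk hS.measurable_c₁)
  have hA₂ : AEStronglyMeasurable A₂ ν :=
    hS.measurable_a₂.prodMk (hS.measurable_b₂.prodMk hS.measurable_c₂)
  have hF := aestronglyMeasurable_coeffOf hf
  have hG := aestronglyMeasurable_coeffOf hg
  have hsum : ∀ᵐ x ∂ν, coeffOf f x = A₁ x + A₂ x := by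
    filter_upwards [hS.density, hS.velocity, hS.temperature] with x h1 h2 h3
    simp only [coeffOf, h1, h2, h3, A₁, A₂, Prod.mk_add_mk]
  have h₆ : eLpNorm A₁ 6 ν ≤ K₆ * phaseNorm Ω 6 (fluid a₁ b₁ c₁) := hK₆ ν A₁ hA₁
  have h₂ : eLpNorm A₂ 2 ν ≤ K₂ * phaseNorm Ω 2 (fluid a₂ b₂ c₂) := hK₂ ν A₂ hA₂
  have hg₂ : eLpNorm (coeffOf g) 2 ν ≤ K₂ * phaseNorm Ω 2 (fluidProj g) := hK₂ ν (coeffOf g) hG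
  have hprod := (eLpNorm_mul_norm_le_of_splitting hG hA₁ hA₂ hsum (hK Ω g)).trans
    (splitting_bound_le K₂ K₆ K h₆ h₂ hg₂)
  have h1 : phaseNorm Ω 2 (fun x => nlCollision B (fluidProj f x) (fluidProj g x)) ≤
      W * eLpNorm (fun x => ‖coeffOf f x‖ * ‖coeffOf g x‖) 2 ν := hW ν (coeffOf f) (coeffOf g) hF hG
  have h2 : phaseNorm Ω 2 (fun x => nlCollision B (fluidProj g x) (fluidProj f x)) ≤
      W * eLpNorm (fun x => ‖coeffOf f x‖ * ‖coeffOf g x‖) 2 ν := by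
    simp only [mul_comm ‖coeffOf f _‖]
    exact hW ν (coeffOf g) (coeffOf f) hG hF
  refine (add_le_add (h1.trans (mul_le_mul_right hprod _))
    (h2.trans (mul_le_mul_right hprod _))).trans_eq ?_
  rw [← two_mul, ← mul_assoc, ← mul_assoc, ENNReal.coe_mul (2 * W), ENNReal.coe_mul 2,
    ENNReal.coe_ofNat]
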